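/- Let $\mathbf{Top}_0$ be the category of $T_0$ topological spaces and continuous maps, order-enriched by the pointwise specialisation order ($x\le y$ iff every open set containing $x$ contains $y$). Regard the following as (non-full) subcategories of $\mathbf{Top}_0$, where posets are viewed as spaces with their Scott topology: - $\mathbf{ALat}$: algebraic lattices, with the maps that preserve directed suprema and all infima; - $\mathbf{ADom}$: bounded complete algebraic domains (directed complete posets in which every element is the directed supremum of the compact elements below it, and every subset with an upper bound has a least one; the empty poset is allowed), with the maps that preserve directed suprema and all non-empty infima; - $\mathbf{Spec}$: spectral spaces, with the spectral maps. Then each of $\mathbf{ALat}$, $\mathbf{ADom}$ and $\mathbf{Spec}$ is closed under weighted limits in $\mathbf{Top}_0$. That is, let $\mathbf{A}$ be one of them, with the order on morphisms inherited from $\mathbf{Top}_0$; let $\mathbf{D}$ be a small order-enriched category, and let $W:\mathbf{D}\to\mathbf{Pos}$ and $G:\mathbf{D}\to\mathbf{A}$ be order-enriched functors. Then $G$, regarded as a diagram in $\mathbf{Top}_0$, has a limit weighted by $W$ in $\mathbf{Top}_0$, and for every such limit $L$ with projections $l_d^x:L\to Gd$ ($d\in\mathbf{D}$, $x\in Wd$),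 the object $L$ and all the morphisms $l_d^x$ belong to $\mathbf{A}$ and form a limit of $G$ weighted by $W$ in $\mathbf{A}$. -/

import Mathlib

open CategoryTheory

universe u v w v' w' v'' w''

/-- An order-enriched category: the hom-sets are posets and composition is monotone in both
variables. -/
class OrderEnriched (C : Type w) [Category.{v} C] where
  homOrder : ∀ X Y : C, PartialOrder (X ⟶ Y)
  comp_le_comp : ∀ {X Y Z : C} {f f' : X ⟶ Y} {g g' : Y ⟶ Z},
    f ≤ f' → g ≤ g' → f ≫ g ≤ f' ≫ g'

attribute [reducible, instance] OrderEnriched.homOrder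

/-- An order-enriched functor: one which preserves the order of each hom-poset. -/
def IsOrderEnrichedFunctor {C : Type w} [Category.{v} C] [OrderEnriched C]
    {C' : Type w'} [Category.{v'} C'] [OrderEnriched C'] (F : C ⥤ C') : Prop :=
  ∀ ⦃X Y : C⦄ ⦃f g : X ⟶ Y⦄, f ≤ g → F.map f ≤ F.map g

/-- The category of posets and monotone maps, with the pointwise order on maps. -/
instance : OrderEnriched PartOrd.{u} where
  homOrder X Y :=
    { le := fun f g => ∀ x : X, f x ≤ g x
      le_refl := fun _ _ => le_rfl
      le_trans := fun _ _ _ h h' x => (h x).trans (h' x)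
      le_antisymm := fun f g h h' => by
        ext x
        exact le_antisymm (h x) (h' x) }
  comp_le_comp := by
    intro X Y Z f f' g g' hf hg x
    exact (g.hom.monotone (hf x)).trans (hg (f' x))

section WeightedLimits

variable {D : Type w'} [Category.{v'} D] {C : Type w} [Category.{v} C] [OrderEnriched C]

/-- A cone over `G : D ⥤ C` weighted by `W : D ⥤ Pos`: an object with morphisms
`proj d x : pt ⟶ G d` for `x ∈ W d`, monotone in `x` and natural in `d`; in other words a natural
transformation from `W` to `C(pt, G -)`. -/
structure WeightedCone (W : D ⥤ PartOrd.{u}) (G : D ⥤ C) where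
  pt : C
  proj : ∀ d : D, W.obj d → (pt ⟶ G.obj d)
  proj_mono : ∀ (d : D) (x y : W.obj d), x ≤ y → proj d x ≤ proj d y
  proj_map : ∀ {d d' : D} (n : d ⟶ d') (x : W.obj d),
    proj d x ≫ G.map n = proj d' (W.map n x)

/-- The weighted cone `c` is a limit of `G` weighted by `W`: composing with its projections gives,
for each object `A`, an isomorphism of posets between the morphisms `A ⟶ c.pt` and the weighted
cones with vertex `A`. -/
structure WeightedCone.IsLimit {W : D ⥤ PartOrd.{u}} {G : D ⥤ C} (c : WeightedCone W G) :
    Prop where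
  existsUnique_lift : ∀ a : WeightedCone W G,
    ∃! t : a.pt ⟶ c.pt, ∀ (d : D) (x : W.obj d), t ≫ c.proj d x = a.proj d x
  le_of_comp_le : ∀ {A : C} (t t' : A ⟶ c.pt),
    (∀ (d : D) (x : W.obj d), t ≫ c.proj d x ≤ t' ≫ c.proj d x) → t ≤ t'

/-- The image of a weighted cone under an order-enriched functor. -/
def WeightedCone.map {C' : Type w''} [Category.{v''} C'] [OrderEnriched C']
    {W : D ⥤ PartOrd.{u}} {G : D ⥤ C} (c : WeightedCone W G)
    (F : C ⥤ C') (hF : IsOrderEnrichedFunctor F) : WeightedCone W (G ⋙ F) where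
  pt := F.obj c.pt
  proj d x := F.map (c.proj d x)
  proj_mono d x y h := hF (c.proj_mono d x y h)
  proj_map n x := by
    rw [Functor.comp_map, ← F.map_comp, c.proj_map]

end WeightedLimits

/-- A (not necessarily full) subcategory of `C`: a class of objects, and a class of morphisms
which contains the identities and is closed under composition. Only the morphisms in `mor` between
objects in `obj` matter. -/
structure Subcat (C : Type w) [Category.{v} C] where
  obj : ObjectProperty C
  mor : MorphismProperty C
  id_mem : ∀ X : C, mor (𝟙 X)
  comp_mem : ∀ {X Y Z : C} (f : X ⟶ Y) (g : Y ⟶ Z), mor f → mor g → mor (f ≫ g)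

namespace Subcat

variable {C : Type w} [Category.{v} C]

/-- The objects of a subcategory. -/
structure Ob (S : Subcat C) where
  val : C
  property : S.obj val

/-- The morphisms of a subcategory. -/
@[ext]
structure Hom {S : Subcat C} (X Y : S.Ob) where
  val : X.val ⟶ Y.val
  property : S.mor val

instance (S : Subcat C) : Category.{v} S.Ob where
  Hom X Y := Hom X Y
  id X := ⟨𝟙 X.val, S.id_mem X.val⟩
  comp f g := ⟨f.val ≫ g.val, S.comp_mem f.val g.val f.property g.property⟩
  id_comp f := Hom.ext (Category.id_comp f.val)
  comp_id f := Hom.ext (Category.comp_id f.val)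
  assoc f g h := Hom.ext (Category.assoc f.val g.val h.val)

/-- The inclusion functor of a subcategory. -/
def incl (S : Subcat C) : S.Ob ⥤ C where
  obj X := X.val
  map f := Hom.val f
  map_id _ := rfl
  map_comp _ _ := rfl

/-- A subcategory of an order-enriched category, with the inherited order on morphisms. -/
instance [OrderEnriched C] (S : Subcat C) : OrderEnriched S.Ob where
  homOrder X Y := PartialOrder.lift (fun f : X ⟶ Y => Hom.val f) (fun _ _ h => Hom.ext h)
  comp_le_comp := fun hf hg => OrderEnriched.comp_le_comp (C := C) hf hg

theorem incl_isOrderEnriched [OrderEnriched C] (S : Subcat C) :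
    IsOrderEnrichedFunctor S.incl :=
  fun _ _ _ _ h => h

/-- The subcategory `S` of `C` is closed under weighted limits in `C`: for every small
order-enriched category `D`, every order-enriched weight `W : D ⥤ Pos` and every order-enriched
diagram `G : D ⥤ S`, the limit of `G` weighted by `W` exists in `C`, and each such limit cone in
`C` lies in `S` (vertex and projections) and is a limit cone in `S`. -/
def ClosedUnderWeightedLimits {C : Type (u + 1)} [Category.{u} C] [OrderEnriched C]
    (S : Subcat C) : Prop :=
  ∀ (D : Type u) [SmallCategory D] [OrderEnriched D]
    (W : D ⥤ PartOrd.{u}) (G : D ⥤ S.Ob),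
    IsOrderEnrichedFunctor W → IsOrderEnrichedFunctor G →
      (∃ c : WeightedCone W (G ⋙ S.incl), c.IsLimit) ∧
      ∀ c : WeightedCone W (G ⋙ S.incl), c.IsLimit →
        ∃ c' : WeightedCone W G, c'.map S.incl S.incl_isOrderEnriched = c ∧ c'.IsLimit

end Subcat

/-- The category of `T₀` topological spaces and continuous maps. -/
abbrev TopT0 : Type (u + 1) :=
  ObjectProperty.FullSubcategory (fun X : TopCat.{u} => T0Space X)

namespace TopT0

/-- The underlying type of a `T₀` space. -/
abbrev pts (X : TopT0.{u}) : Type u := X.obj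

/-- The underlying continuous map of a morphism. -/
abbrev toMap {X Y : TopT0.{u}} (f : X ⟶ Y) : C(X.pts, Y.pts) := f.hom.hom

instance (X : TopT0.{u}) : T0Space X.pts := X.property

/-- The specialisation order: `x ≤ y` iff every open set containing `x` contains `y`. -/
instance (X : TopT0.{u}) : PartialOrder X.pts := specializationOrder X.pts

/-- `Top₀` is order-enriched by the pointwise specialisation order. -/
instance : OrderEnriched TopT0.{u} where
  homOrder X Y :=
    { le := fun f g => ∀ x : X.pts, toMap f x ≤ toMap g x
      le_refl := fun _ _ => le_rfl
      le_trans := fun _ _ _ h h' x => (h x).trans (h' x)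
      le_antisymm := fun f g h h' => by
        ext x
        exact le_antisymm (h x) (h' x) }
  comp_le_comp := by
    intro X Y Z f f' g g' hf hg x
    exact le_trans (b := toMap g (toMap f' x))
      (Specializes.map (hf x) (toMap g).continuous) (hg (toMap f' x))

end TopT0

section Domains

variable (P : Type u) [PartialOrder P]

/-- Every directed subset has a supremum (directed sets are non-empty). -/
def IsDirectedComplete : Prop :=
  ∀ S : Set P, S.Nonempty → DirectedOn (· ≤ ·) S → ∃ a, IsLUB S a

/-- An algebraic domain: a directed complete poset in which every element is the directed supremum
of the compact elements below it (such a poset is automatically continuous). -/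
def IsAlgebraicDomain : Prop :=
  IsDirectedComplete P ∧
    ∀ x : P, {k : P | k ≤ x ∧ IsCompactElement k}.Nonempty ∧
      DirectedOn (· ≤ ·) {k : P | k ≤ x ∧ IsCompactElement k} ∧
      IsLUB {k : P | k ≤ x ∧ IsCompactElement k} x

/-- An algebraic lattice: an algebraic domain which is a complete lattice. -/
def IsAlgebraicLattice : Prop :=
  IsAlgebraicDomain P ∧ ∀ S : Set P, ∃ a, IsLUB S a

/-- Bounded complete: every subset with an upper bound has a least one. -/
def IsBoundedComplete : Prop :=
  ∀ S : Set P, BddAbove S → ∃ a, IsLUB S a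

end Domains

open TopT0

/-- The category `ALat` of algebraic lattices and maps preserving directed suprema and all infima,
as a subcategory of `Top₀`: a space is an algebraic lattice with its Scott topology if it carries
the Scott topology of its specialisation order and this order is an algebraic lattice. -/
def ALat : Subcat TopT0.{u} where
  obj X := IsAlgebraicLattice X.pts ∧ Topology.IsScott X.pts Set.univ
  mor X Y f := ScottContinuous (toMap f) ∧
    ∀ (S : Set X.pts) (a : X.pts), IsGLB S a → IsGLB (toMap f '' S) (toMap f a)
  id_mem X := by
    refine ⟨fun d _ _ a h => ?_, fun S a h => ?_⟩ <;> simpa [toMap] using h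
  comp_mem f g hf hg := by
    refine ⟨?_, fun S a h => ?_⟩
    · intro d hd hd' a ha
      have := hg.1 (hd.image _) (hd'.mono_comp hf.1.monotone) (hf.1 hd hd' ha)
      rw [Set.image_image] at this
      exact this
    · have := hg.2 _ _ (hf.2 S a h)
      rw [Set.image_image] at this
      exact this

/-- The category `ADom` of bounded complete algebraic domains and maps preserving directed suprema
and all non-empty infima, as a subcategory of `Top₀` by means of the Scott topology. -/
def ADom : Subcat TopT0.{u} where
  obj X := IsAlgebraicDomain X.pts ∧ IsBoundedComplete X.pts ∧ Topology.IsScott X.pts Set.univ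
  mor X Y f := ScottContinuous (toMap f) ∧
    ∀ (S : Set X.pts) (a : X.pts), S.Nonempty → IsGLB S a →
      IsGLB (toMap f '' S) (toMap f a)
  id_mem X := by
    refine ⟨fun d _ _ a h => ?_, fun S a _ h => ?_⟩ <;> simpa [toMap] using h
  comp_mem f g hf hg := by
    refine ⟨?_, fun S a hS h => ?_⟩
    · intro d hd hd' a ha
      have := hg.1 (hd.image _) (hd'.mono_comp hf.1.monotone) (hf.1 hd hd' ha)
      rw [Set.image_image] at this
      exact this
    · have := hg.2 _ _ (hS.image _) (hf.2 S a hS h)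
      rw [Set.image_image] at this
      exact this

/-- The category `Spec` of spectral spaces and spectral maps, as a subcategory of `Top₀`. -/
def SpecSp : Subcat TopT0.{u} where
  obj X := SpectralSpace X.pts
  mor _ _ f := IsSpectralMap (toMap f)
  id_mem _ := isSpectralMap_id
  comp_mem _ _ hf hg := hg.comp hf

/-! A weighted limit in `TopT0` is, up to isomorphism, the subspace of a product formed by the
compatible families. Hence its topology is induced by the projections, its order is componentwise,
and every compatible family is realised by a point. A map into it preserves suprema or infima if its
composites with the projections do; spectrality is likewise tested on projections. It remains to
place the vertex and the projections in the subcategory.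

For domains, componentwise directed suprema and non-empty infima of compatible families are again
compatible, because the diagram maps preserve them. So the projections preserve both and have
partial left adjoints, which send compact elements to compact elements (`exists_adjoint`,
`isCompactElement_adjoint`). These values, with finite joins, yield algebraicity and show that the
induced topology is the Scott topology (`isScott`). For `ALat` the top element is added.

For spectral spaces, the compatible families form a closed set in the product of the constructible
topologies, hence a compact space `Q` mapping onto the limit. The compact open sets of the limit are
the open sets with clopen preimage in `Q`, and spectrality follows from compactness of `Q`. -/

/-- A subcategory is closed under weighted limits as soon as the ambient category has them, and the
vertex and the projections of every limit cone lie in the subcategory, the latter jointly reflecting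
its morphisms. -/
theorem Subcat.closedUnderWeightedLimits_of_isLimit {C : Type (u + 1)} [Category.{u} C]
    [OrderEnriched C] (S : Subcat C)
    (hC : ∀ (D : Type u) [SmallCategory D] (W : D ⥤ PartOrd.{u}) (G : D ⥤ C),
      ∃ c : WeightedCone W G, c.IsLimit)
    (hS : ∀ (D : Type u) [SmallCategory D] (W : D ⥤ PartOrd.{u}) (G : D ⥤ S.Ob)
      (c : WeightedCone W (G ⋙ S.incl)), c.IsLimit →
      S.obj c.pt ∧ (∀ d x, S.mor (c.proj d x)) ∧
        ∀ (A : C) (t : A ⟶ c.pt), S.obj A → (∀ d x, S.mor (t ≫ c.proj d x)) → S.mor t) :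
    S.ClosedUnderWeightedLimits := by
  intro D _ _ W G _ _
  refine ⟨hC D W (G ⋙ S.incl), fun c hc => ?_⟩
  obtain ⟨hpt, hproj, hlift⟩ := hS D W G c hc
  refine ⟨{ pt := ⟨c.pt, hpt⟩
            proj := fun d x => ⟨c.proj d x, hproj d x⟩
            proj_mono := c.proj_mono
            proj_map := fun n x => Subcat.Hom.ext (c.proj_map n x) }, rfl, ?_, ?_⟩
  · intro a
    obtain ⟨t, ht, htu⟩ :=
      hc.existsUnique_lift (a.map S.incl S.incl_isOrderEnriched)
    refine ⟨⟨t, hlift _ t a.pt.property fun d x => ?_⟩, fun d x => Subcat.Hom.ext (ht d x), ?_⟩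
    · rw [ht d x]
      exact (a.proj d x).property
    · intro t' ht'
      exact Subcat.Hom.ext (htu t'.val fun d x => congrArg Subcat.Hom.val (ht' d x))
  · intro A t t' h
    exact hc.le_of_comp_le t.val t'.val h

/-! ### Weighted limits in `TopT0` -/

/-- A subspace of an iterated product carries the topology induced by its coordinates. -/
theorem subtype_pi_topology_eq {ι : Type u} {κ : ι → Type v} {X : ι → Type w}
    [t : ∀ i, TopologicalSpace (X i)] (P : (∀ i, κ i → X i) → Prop) :
    (inferInstance : TopologicalSpace {p : ∀ i, κ i → X i // P p}) =
      ⨅ i : Σ i, κ i, (t i.1).induced fun p => p.1 i.1 i.2 := by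
  refine le_antisymm (le_iInf fun i => Continuous.le_induced ?_) ?_
  · exact (continuous_apply i.2).comp ((continuous_apply i.1).comp continuous_subtype_val)
  · let : TopologicalSpace {p : ∀ i, κ i → X i // P p} :=
      ⨅ i : Σ i, κ i, (t i.1).induced fun p => p.1 i.1 i.2
    refine Continuous.le_induced (f := Subtype.val) ?_
    exact continuous_pi fun i => continuous_pi fun x =>
      continuous_iff_le_induced.2 (iInf_le _ (⟨i, x⟩ : Σ i, κ i))

namespace TopT0

/-- The continuous maps between `T₀` spaces, as morphisms of `TopT0`. -/
def ofMap {X Y : TopT0.{u}} (f : C(X.pts, Y.pts)) : X ⟶ Y :=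
  ObjectProperty.homMk (TopCat.ofHom f)

variable {D : Type u} [SmallCategory D] (W : D ⥤ PartOrd.{u}) (G : D ⥤ TopT0.{u})

/-- The compatible families of points of a weighted diagram: those monotone in the weight and
natural in the index. -/
def IsCompatible (p : ∀ d : D, W.obj d → (G.obj d).pts) : Prop :=
  (∀ (d : D) (x y : W.obj d), x ≤ y → p d x ≤ p d y) ∧
    ∀ (d d' : D) (n : d ⟶ d') (x : W.obj d), toMap (G.map n) (p d x) = p d' (W.map n x)

/-- The cone of compatible families, topologised as a subspace of the product. -/
def compatibleCone : WeightedCone W G where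
  pt := ⟨TopCat.of {p : ∀ d : D, W.obj d → (G.obj d).pts // IsCompatible W G p},
    inferInstanceAs (T0Space {p : ∀ d : D, W.obj d → (G.obj d).pts // IsCompatible W G p})⟩
  proj d x := ofMap ⟨fun p => p.1 d x,
    (continuous_apply x).comp ((continuous_apply d).comp continuous_subtype_val)⟩
  proj_mono d x y h p := p.2.1 d x y h
  proj_map n x := by
    ext p
    exact p.2.2 _ _ n x

variable {W G}

theorem WeightedCone.isCompatible (a : WeightedCone W G) (z : a.pt.pts) :
    IsCompatible W G fun d x => toMap (a.proj d x) z :=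
  ⟨fun d x y h => a.proj_mono d x y h z,
    fun _ _ n x => congrArg (fun f => toMap f z) (a.proj_map n x)⟩

theorem compatibleCone_specializes (p q : (compatibleCone W G).pt.pts)
    (h : ∀ d x, toMap ((compatibleCone W G).proj d x) p ≤
      toMap ((compatibleCone W G).proj d x) q) : p ≤ q := by
  change (q ⤳ p)
  refine Topology.IsInducing.subtypeVal.specializes_iff.1 ?_
  rw [specializes_pi]
  intro d
  rw [specializes_pi]
  exact h d

variable (W G)

theorem compatibleCone_isLimit : (compatibleCone W G).IsLimit where
  existsUnique_lift a := by
    refine ⟨ofMap ⟨fun z => ⟨_, WeightedCone.isCompatible a z⟩, ?_⟩, fun d x => rfl, ?_⟩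
    · exact Continuous.subtype_mk
        (continuous_pi fun d => continuous_pi fun x => (toMap (a.proj d x)).continuous) _
    · intro t ht
      ext z
      refine Subtype.ext (funext fun d => funext fun x => ?_)
      exact congrArg (fun f => toMap f z) (ht d x)
  le_of_comp_le t t' h z := compatibleCone_specializes _ _ fun d x => h d x z

theorem compatibleCone_topology_eq :
    (compatibleCone W G).pt.obj.str = ⨅ i : Σ d, W.obj d,
      (G.obj i.1).obj.str.induced (toMap ((compatibleCone W G).proj i.1 i.2)) :=
  subtype_pi_topology_eq _

variable {W G}

/-- Uniqueness of limits, by which the properties of the explicit cone pass to every limit cone. -/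
theorem WeightedCone.IsLimit.exists_iso {c : WeightedCone W G} (hc : c.IsLimit) :
    ∃ e : c.pt ≅ (compatibleCone W G).pt, ∀ d x,
      e.hom ≫ (compatibleCone W G).proj d x = c.proj d x := by
  obtain ⟨t, ht, -⟩ := (compatibleCone_isLimit W G).existsUnique_lift c
  obtain ⟨s, hs, -⟩ := hc.existsUnique_lift (compatibleCone W G)
  refine ⟨⟨t, s, ?_, ?_⟩, ht⟩
  · refine (hc.existsUnique_lift c).unique (fun d x => ?_) fun d x => Category.id_comp _
    rw [Category.assoc, hs, ht]
  · refine ((compatibleCone_isLimit W G).existsUnique_lift (compatibleCone W G)).unique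
      (fun d x => ?_) fun d x => Category.id_comp _
    rw [Category.assoc, ht, hs]

/-- The topology of the vertex of a weighted limit is induced by the projections. -/
theorem WeightedCone.IsLimit.topology_eq {c : WeightedCone W G} (hc : c.IsLimit) :
    c.pt.obj.str = ⨅ i : Σ d, W.obj d,
      (G.obj i.1).obj.str.induced (toMap (c.proj i.1 i.2)) := by
  obtain ⟨e, he⟩ := WeightedCone.IsLimit.exists_iso hc
  have h := (TopCat.homeoOfIso ((ObjectProperty.ι _).mapIso e)).isInducing.eq_induced
  refine h.trans ((congrArg _ (compatibleCone_topology_eq W G)).trans ?_)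
  simp only [induced_iInf, induced_compose, ← he]
  rfl

/-- Every compatible family is realised by a point of the vertex of a weighted limit. -/
theorem WeightedCone.IsLimit.exists_point {c : WeightedCone W G} (hc : c.IsLimit)
    {p : ∀ d : D, W.obj d → (G.obj d).pts} (hp : IsCompatible W G p) :
    ∃ z : c.pt.pts, ∀ d x, toMap (c.proj d x) z = p d x := by
  obtain ⟨e, he⟩ := WeightedCone.IsLimit.exists_iso hc
  refine ⟨toMap e.inv (show (compatibleCone W G).pt.pts from ⟨p, hp⟩), fun d x => ?_⟩
  have h : e.inv ≫ c.proj d x = (compatibleCone W G).proj d x := by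
    rw [← he, e.inv_hom_id_assoc]
  exact congrArg (fun f => toMap f (show (compatibleCone W G).pt.pts from ⟨p, hp⟩)) h

/-- The projections of a weighted limit jointly reflect the specialisation order. -/
theorem WeightedCone.IsLimit.le_iff {c : WeightedCone W G} (hc : c.IsLimit) (y z : c.pt.pts) :
    y ≤ z ↔ ∀ i : Σ d, W.obj d, toMap (c.proj i.1 i.2) y ≤ toMap (c.proj i.1 i.2) z := by
  refine ⟨fun h i => Specializes.map h (toMap _).continuous, fun h => ?_⟩
  obtain ⟨e, he⟩ := WeightedCone.IsLimit.exists_iso hc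
  have hi := (TopCat.homeoOfIso ((ObjectProperty.ι _).mapIso e)).isInducing
  refine hi.specializes_iff.1 (compatibleCone_specializes (W := W) (G := G) _ _ fun d x => ?_)
  have := h ⟨d, x⟩
  simp only [← he] at this
  exact this

end TopT0

/-! ### Algebraic domains and the Scott topology -/

theorem IsAlgebraicDomain.le_iff {P : Type u} [PartialOrder P] (hP : IsAlgebraicDomain P)
    {x y : P} : x ≤ y ↔ ∀ k, IsCompactElement k → k ≤ x → k ≤ y :=
  ⟨fun h _ _ hk => hk.trans h, fun h => (hP.2 x).2.2.2 fun k hk => h k hk.2 hk.1⟩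

/-- Any element of `S` bounds the set of lower bounds, whose supremum is then the infimum of `S`. -/
theorem IsBoundedComplete.exists_isGLB {P : Type u} [PartialOrder P] (hP : IsBoundedComplete P)
    {S : Set P} (hS : S.Nonempty) : ∃ a, IsGLB S a := by
  obtain ⟨a, ha⟩ := hP (lowerBounds S) (hS.mono fun _ hx _ hy => hy hx)
  exact ⟨a, isLUB_lowerBounds.1 ha⟩

theorem isCompactElement_isLUB_pair {P : Type u} [PartialOrder P] {a b c : P}
    (ha : IsCompactElement a) (hb : IsCompactElement b) (hc : IsLUB {a, b} c) :
    IsCompactElement c := by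
  intro S s hS hd hs hcs
  obtain ⟨x, hx, hax⟩ := ha S s hS hd hs ((hc.1 (by simp)).trans hcs)
  obtain ⟨y, hy, hby⟩ := hb S s hS hd hs ((hc.1 (by simp)).trans hcs)
  obtain ⟨z, hz, hxz, hyz⟩ := hd x hx y hy
  refine ⟨z, hz, hc.2 ?_⟩
  rintro _ (rfl | rfl)
  exacts [hax.trans hxz, hby.trans hyz]

theorem isCompactElement_of_isLeast {P : Type u} [PartialOrder P] {a : P} (ha : ∀ x, a ≤ x) :
    IsCompactElement a :=
  fun _ _ ⟨x, hx⟩ _ _ _ => ⟨x, hx, ha x⟩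

/-- For a Scott topology the up-set of a compact element is open. -/
theorem IsCompactElement.isOpen_Ici {P : Type u} [PartialOrder P] [TopologicalSpace P]
    [Topology.IsScott P Set.univ] {k : P} (hk : IsCompactElement k) : IsOpen (Set.Ici k) := by
  rw [Topology.IsScott.isOpen_iff_isUpperSet_and_dirSupInaccOn (D := Set.univ)]
  refine ⟨isUpperSet_Ici k, fun S _ hS hd a ha hka => ?_⟩
  obtain ⟨x, hx, hkx⟩ := hk S a hS hd ha hka
  exact ⟨x, hx, hkx⟩

/-- An order `L` with maps `l i` to bounded complete algebraic domains which jointly reflect the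
order, such that `L` is closed under componentwise directed suprema and non-empty infima. -/
structure IsDomainSource {ι : Type v} {L : Type u} [PartialOrder L] {X : ι → Type w}
    [∀ i, PartialOrder (X i)] (l : ∀ i, L → X i) : Prop where
  algebraic : ∀ i, IsAlgebraicDomain (X i)
  le_iff : ∀ x y, x ≤ y ↔ ∀ i, l i x ≤ l i y
  exists_sup : ∀ S : Set L, S.Nonempty → DirectedOn (· ≤ ·) S →
    ∃ a, ∀ i, IsLUB (l i '' S) (l i a)
  exists_inf : ∀ S : Set L, S.Nonempty → ∃ a, ∀ i, IsGLB (l i '' S) (l i a)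

namespace IsDomainSource

variable {ι : Type v} {L : Type u} [PartialOrder L] {X : ι → Type w}
    [∀ i, PartialOrder (X i)] {l : ∀ i, L → X i}

theorem isLUB_of_forall (h : ∀ x y, x ≤ y ↔ ∀ i, l i x ≤ l i y) {S : Set L} {a : L}
    (ha : ∀ i, IsLUB (l i '' S) (l i a)) : IsLUB S a :=
  ⟨fun x hx => (h _ _).2 fun i => (ha i).1 ⟨x, hx, rfl⟩,
    fun y hy => (h _ _).2 fun i => (ha i).2 <| by
      rintro _ ⟨x, hx, rfl⟩
      exact (h _ _).1 (hy hx) i⟩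

theorem isGLB_of_forall (h : ∀ x y, x ≤ y ↔ ∀ i, l i x ≤ l i y) {S : Set L} {a : L}
    (ha : ∀ i, IsGLB (l i '' S) (l i a)) : IsGLB S a :=
  ⟨fun x hx => (h _ _).2 fun i => (ha i).1 ⟨x, hx, rfl⟩,
    fun y hy => (h _ _).2 fun i => (ha i).2 <| by
      rintro _ ⟨x, hx, rfl⟩
      exact (h _ _).1 (hy hx) i⟩

variable (h : IsDomainSource l)
include h

theorem scottContinuous (i : ι) : ScottContinuous (l i) := by
  intro S hS hd a ha
  obtain ⟨b, hb⟩ := h.exists_sup S hS hd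
  rw [ha.unique (isLUB_of_forall h.le_iff hb)]
  exact hb i

theorem map_isGLB (i : ι) {S : Set L} {a : L} (hS : S.Nonempty) (ha : IsGLB S a) :
    IsGLB (l i '' S) (l i a) := by
  obtain ⟨b, hb⟩ := h.exists_inf S hS
  rw [ha.unique (isGLB_of_forall h.le_iff hb)]
  exact hb i

theorem isBoundedComplete : IsBoundedComplete L := by
  intro S hS
  obtain ⟨a, ha⟩ := h.exists_inf (upperBounds S) hS
  exact ⟨a, isGLB_upperBounds.1 (isGLB_of_forall h.le_iff ha)⟩

/-- A partial left adjoint of `l i`: `r` is the infimum of all `x` with `k ≤ l i x`, and `l i`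
preserves it. Some such `x` must exist, since only non-empty infima are available. -/
theorem exists_adjoint (i : ι) {k : X i} (hk : ∃ x, k ≤ l i x) :
    ∃ r : L, ∀ x, r ≤ x ↔ k ≤ l i x := by
  obtain ⟨r, hr⟩ := h.exists_inf {x | k ≤ l i x} hk
  refine ⟨r, fun x => ⟨fun hx => ?_, fun hx => (isGLB_of_forall h.le_iff hr).1 hx⟩⟩
  refine le_trans ((hr i).2 ?_) ((h.le_iff _ _).1 hx i)
  rintro _ ⟨y, hy, rfl⟩
  exact hy

/-- Left adjoints of maps that preserve directed suprema preserve compactness. -/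
theorem isCompactElement_adjoint (i : ι) {k : X i} (hk : IsCompactElement k) {r : L}
    (hr : ∀ x, r ≤ x ↔ k ≤ l i x) : IsCompactElement r := by
  intro S a hS hd ha hra
  obtain ⟨_, ⟨x, hx, rfl⟩, hkx⟩ := hk (l i '' S) (l i a) (hS.image _)
    (hd.mono_comp (h.scottContinuous i).monotone) (h.scottContinuous i hS hd ha) ((hr a).1 hra)
  exact ⟨x, hx, (hr x).2 hkx⟩

theorem isAlgebraicDomain : IsAlgebraicDomain L := by
  refine ⟨fun S hS hd => ?_, fun x => ⟨?_, ?_, ?_⟩⟩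
  · obtain ⟨a, ha⟩ := h.exists_sup S hS hd
    exact ⟨a, isLUB_of_forall h.le_iff ha⟩
  -- The supremum of the empty set, bounded by `x`, is a least element; `L` itself may be empty.
  · obtain ⟨b, hb⟩ := h.isBoundedComplete ∅ ⟨x, by simp⟩
    rw [isLUB_empty_iff] at hb
    exact ⟨b, hb x, isCompactElement_of_isLeast hb⟩
  · rintro a ⟨ha, hac⟩ b ⟨hb, hbc⟩
    have hx : x ∈ upperBounds {a, b} := by
      rintro _ (rfl | rfl) <;> assumption
    obtain ⟨c, hc⟩ := h.isBoundedComplete {a, b} ⟨x, hx⟩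
    exact ⟨c, ⟨hc.2 hx, isCompactElement_isLUB_pair hac hbc hc⟩, hc.1 (by simp), hc.1 (by simp)⟩
  · refine ⟨fun k hk => hk.1, fun y hy => (h.le_iff _ _).2 fun i => ?_⟩
    refine (h.algebraic i).le_iff.2 fun k hk hkx => ?_
    obtain ⟨r, hr⟩ := h.exists_adjoint i ⟨x, hkx⟩
    exact (hr y).1 (hy ⟨(hr x).2 hkx, h.isCompactElement_adjoint i hk hr⟩)

/-- The topology induced by the maps `l i` from the Scott topologies is the Scott topology. -/
theorem isScott [tL : TopologicalSpace L] [t : ∀ i, TopologicalSpace (X i)]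
    [∀ i, Topology.IsScott (X i) Set.univ] (ht : tL = ⨅ i, (t i).induced (l i)) :
    Topology.IsScott L Set.univ := by
  have hcont (i : ι) : Continuous (l i) :=
    continuous_iff_le_induced.2 (ht.trans_le (iInf_le _ i))
  have hopen (i : ι) {k : X i} (hk : IsCompactElement k) : IsOpen {x | k ≤ l i x} :=
    hk.isOpen_Ici.preimage (hcont i)
  constructor
  let tS : TopologicalSpace L := Topology.scott L Set.univ
  have : @Topology.IsScott L Set.univ _ tS := @Topology.IsScott.mk _ _ _ tS rfl
  refine le_antisymm (fun U hU => ?_) ?_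
  -- Scott open sets are open in the induced topology: some principal up-set open in that topology
  -- lies between `x` and `U`.
  · rw [Topology.IsScott.isOpen_iff_isUpperSet_and_dirSupInaccOn (D := Set.univ)] at hU
    rw [@isOpen_iff_forall_mem_open _ tL]
    intro x hx
    -- finite suprema of adjoints of compact elements approximate `x`
    let B : Set L := {b | b ≤ x ∧ @IsOpen L tL (Set.Ici b)}
    have hB₁ : B.Nonempty := by
      obtain ⟨b, hb⟩ := h.isBoundedComplete ∅ ⟨x, by simp⟩
      rw [isLUB_empty_iff] at hb
      refine ⟨b, hb x, ?_⟩
      rw [show Set.Ici b = Set.univ from Set.eq_univ_of_forall hb]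
      exact @isOpen_univ _ tL
    have hB₂ : DirectedOn (· ≤ ·) B := by
      rintro a ⟨ha, hao⟩ b ⟨hb, hbo⟩
      have hx : x ∈ upperBounds {a, b} := by
        rintro _ (rfl | rfl) <;> assumption
      obtain ⟨c, hc⟩ := h.isBoundedComplete {a, b} ⟨x, hx⟩
      refine ⟨c, ⟨hc.2 hx, ?_⟩, hc.1 (by simp), hc.1 (by simp)⟩
      have : Set.Ici c = Set.Ici a ∩ Set.Ici b := by
        ext y
        rw [Set.mem_Ici, isLUB_le_iff hc]
        simp [upperBounds]
      rw [this]
      exact @IsOpen.inter L tL _ _ hao hbo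
    have hB₃ : IsLUB B x := by
      refine ⟨fun b hb => hb.1, fun y hy => (h.le_iff _ _).2 fun i => ?_⟩
      refine (h.algebraic i).le_iff.2 fun k hk hkx => ?_
      obtain ⟨r, hr⟩ := h.exists_adjoint i ⟨x, hkx⟩
      refine (hr y).1 (hy ⟨(hr x).2 hkx, ?_⟩)
      rw [show Set.Ici r = {x | k ≤ l i x} from Set.ext hr]
      exact hopen i hk
    obtain ⟨b, hb, hbU⟩ := hU.2 trivial hB₁ hB₂ hB₃ hx
    exact ⟨Set.Ici b, fun y hy => hU.1 hy hbU, hb.2, hb.1⟩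
  -- Conversely, each `l i` is continuous for the Scott topologies.
  · rw [ht]
    refine le_iInf fun i => continuous_iff_le_induced.1 ?_
    rw [← Topology.IsScott.scottContinuousOn_iff_continuous (D := Set.univ) (by simp),
      scottContinuousOn_univ]
    exact h.scottContinuous i

end IsDomainSource

/-! ### Topologies induced by maps to spectral spaces -/

open TopologicalSpace in
/-- The finite intersections of preimages of compact open sets form a basis of the topology induced
by maps to prespectral spaces. -/
theorem isTopologicalBasis_iInf_induced_compactOpen {L ι : Type*} {X : ι → Type*}
    [tL : TopologicalSpace L] [t : ∀ i, TopologicalSpace (X i)] [∀ i, PrespectralSpace (X i)]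
    {l : ∀ i, L → X i} (ht : tL = ⨅ i, (t i).induced (l i)) :
    IsTopologicalBasis {S | ∃ (U : ∀ i, Set (X i)) (F : Finset ι),
      (∀ i ∈ F, IsOpen (U i) ∧ IsCompact (U i)) ∧ S = ⋂ (i) (_ : i ∈ F), l i ⁻¹' U i} := by
  rw [ht]
  exact IsTopologicalBasis.iInf_induced (fun _ => PrespectralSpace.isTopologicalBasis) l

/-- A map into a space with the topology induced by maps to prespectral spaces is spectral if its
composites with these maps are. -/
theorem IsSpectralMap.of_comp {L ι : Type*} {X : ι → Type*}
    [tL : TopologicalSpace L] [t : ∀ i, TopologicalSpace (X i)] [∀ i, PrespectralSpace (X i)]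
    {l : ∀ i, L → X i} (ht : tL = ⨅ i, (t i).induced (l i)) {A : Type*} [TopologicalSpace A]
    [CompactSpace A] [QuasiSeparatedSpace A] {f : A → L} (hf : Continuous f)
    (hl : ∀ i, IsSpectralMap (l i ∘ f)) : IsSpectralMap f := by
  refine ⟨hf, fun K hKo hK => ?_⟩
  have hb := isTopologicalBasis_iInf_induced_compactOpen ht
  rw [← Subtype.range_coe (s := {S | _})] at hb
  obtain ⟨s, hs, rfl⟩ := eq_finite_iUnion_of_isTopologicalBasis_of_isCompact_open _ hb K hK hKo
  simp only [Set.preimage_iUnion]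
  refine hs.isCompact_biUnion ?_
  rintro ⟨_, U, F, hU, rfl⟩ -
  have : f ⁻¹' (⋂ (i) (_ : i ∈ F), l i ⁻¹' U i) =
      ⋂₀ ((fun i => (l i ∘ f) ⁻¹' U i) '' (F : Set ι)) := by
    simp only [Set.sInter_image, Set.preimage_iInter]
    rfl
  rw [this]
  -- For empty `F` the intersection is all of `A`, which is compact.
  refine QuasiSeparatedSpace.isCompact_sInter (F.finite_toSet.image _) ?_ ?_
  · rintro _ ⟨i, hi, rfl⟩
    exact Or.inl ((hU i hi).1.preimage (hl i).continuous)
  · rintro _ ⟨i, hi, rfl⟩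
    exact (hl i).isCompact_preimage_of_isOpen (hU i hi).1 (hU i hi).2

section Patch

variable {L ι : Type*} {X : ι → Type*} [tL : TopologicalSpace L] [t : ∀ i, TopologicalSpace (X i)]
  [∀ i, PrespectralSpace (X i)] {l : ∀ i, L → X i} {Q : Type*} [TopologicalSpace Q] {q : Q → L}

open TopologicalSpace in
-- The open sets with clopen preimage stand in for the compact open sets. They contain the finite
-- intersections of preimages of compact open sets, which already form a basis.
theorem isTopologicalBasis_isClopen_preimage (ht : tL = ⨅ i, (t i).induced (l i))
    (hq : ∀ i U, IsOpen U → IsCompact U → IsClopen (q ⁻¹' (l i ⁻¹' U))) :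
    IsTopologicalBasis {V : Set L | IsOpen V ∧ IsClopen (q ⁻¹' V)} := by
  refine (isTopologicalBasis_iInf_induced_compactOpen ht).of_isOpen_of_subset (fun V hV => hV.1) ?_
  intro V hV
  refine ⟨(isTopologicalBasis_iInf_induced_compactOpen ht).isOpen hV, ?_⟩
  obtain ⟨U, F, hU, rfl⟩ := hV
  simp only [Set.preimage_iInter]
  exact isClopen_biInter_finset fun i hi => hq i _ (hU i hi).1 (hU i hi).2

variable [CompactSpace Q]

/-- `V` is the image of a closed subset of the compact space `Q` under the continuous map `q`. -/
theorem isCompact_of_isClosed_preimage (ht : tL = ⨅ i, (t i).induced (l i))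
    (hq : ∀ i U, IsOpen U → IsCompact U → IsClopen (q ⁻¹' (l i ⁻¹' U)))
    (hs : Function.Surjective q) {V : Set L} (hV : IsClosed (q ⁻¹' V)) : IsCompact V := by
  have hc : Continuous q :=
    (isTopologicalBasis_isClopen_preimage ht hq).continuous_iff.2 fun V hV => hV.2.isOpen
  rw [← Set.image_preimage_eq V hs]
  exact hV.isCompact.image hc

/-- A compact open set is a finite union of basic sets with clopen preimage. -/
theorem isCompact_iff_isClopen_preimage (ht : tL = ⨅ i, (t i).induced (l i))
    (hq : ∀ i U, IsOpen U → IsCompact U → IsClopen (q ⁻¹' (l i ⁻¹' U)))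
    (hs : Function.Surjective q) {V : Set L} (hV : IsOpen V) :
    IsCompact V ↔ IsClopen (q ⁻¹' V) := by
  refine ⟨fun hc => ?_, fun h => isCompact_of_isClosed_preimage ht hq hs h.1⟩
  have hb := isTopologicalBasis_isClopen_preimage ht hq
  rw [← Subtype.range_coe (s := {S | _})] at hb
  obtain ⟨s, hs, rfl⟩ := eq_finite_iUnion_of_isTopologicalBasis_of_isCompact_open _ hb V hc hV
  simp only [Set.preimage_iUnion]
  exact hs.isClopen_biUnion fun i _ => i.2.2

/-- A `T₀` space whose topology is induced by maps to spectral spaces is spectral if it is the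
image of a compact space such that the preimages of compact open sets are clopen. -/
theorem SpectralSpace.of_isClopen_preimage [T0Space L] (ht : tL = ⨅ i, (t i).induced (l i))
    (hq : ∀ i U, IsOpen U → IsCompact U → IsClopen (q ⁻¹' (l i ⁻¹' U)))
    (hs : Function.Surjective q) : SpectralSpace L := by
  have hb := isTopologicalBasis_isClopen_preimage ht hq
  have hcl {V : Set L} (hV : IsClosed V) : IsClosed (q ⁻¹' V) :=
    hV.preimage (hb.continuous_iff.2 fun V hV => hV.2.isOpen)
  exact
  { isCompact_univ := isCompact_of_isClosed_preimage ht hq hs isClosed_univ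
    inter_isCompact := fun U V hU hUc hV hVc => by
      rw [isCompact_iff_isClopen_preimage ht hq hs hU] at hUc
      rw [isCompact_iff_isClopen_preimage ht hq hs hV] at hVc
      rw [isCompact_iff_isClopen_preimage ht hq hs (hU.inter hV)]
      exact hUc.inter hVc
    toPrespectralSpace := .of_isTopologicalBasis hb fun V hV =>
      isCompact_of_isClosed_preimage ht hq hs hV.2.1
    sober := fun {Z} hZ hZc => by
      -- A generic point of `Z` must lie in `Z` and in every basic set that meets `Z`.
      -- Irreducibility gives the finite intersection property for the preimages, and compactness of
      -- `Q` gives the point.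
      let K := {V : Set L // (IsOpen V ∧ IsClopen (q ⁻¹' V)) ∧ (Z ∩ V).Nonempty}
      obtain ⟨y, hyZ, hyV⟩ := (hcl hZc).isCompact.inter_iInter_nonempty
        (fun V : K => q ⁻¹' V.1) (fun V => V.2.1.2.1) fun F => by
          classical
          obtain ⟨z, hzZ, hz⟩ := isIrreducible_iff_sInter.1 hZ (F.image Subtype.val)
            (by simp +contextual) (by simp +contextual)
          obtain ⟨y, rfl⟩ := hs z
          refine ⟨y, hzZ, ?_⟩
          simp only [Set.mem_iInter]
          exact fun V hV => hz V.1 (by simpa using ⟨V.2, hV⟩)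
      refine ⟨q y, subset_antisymm (closure_minimal (by simpa using hyZ) hZc) fun z hz => ?_⟩
      rw [hb.mem_closure_iff]
      intro V hV hzV
      exact ⟨q y, Set.mem_iInter.1 hyV ⟨V, hV, z, hz, hzV⟩, rfl⟩ }

theorem IsSpectralMap.of_isClopen_preimage (ht : tL = ⨅ i, (t i).induced (l i))
    (hq : ∀ i U, IsOpen U → IsCompact U → IsClopen (q ⁻¹' (l i ⁻¹' U)))
    (hs : Function.Surjective q) (i : ι) : IsSpectralMap (l i) :=
  ⟨continuous_iff_le_induced.2 (ht.trans_le (iInf_le _ i)), fun U hU hUc =>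
    isCompact_of_isClosed_preimage ht hq hs (hq i U hU hUc).1⟩

end Patch

/-- If the preimages of compact open sets are clopen, then specialisation is a closed condition. -/
theorem isClosed_setOf_specializes_of_isClopen {Q X : Type*} [TopologicalSpace Q]
    [TopologicalSpace X]
    [PrespectralSpace X] {f g : Q → X}
    (hf : ∀ U, IsOpen U → IsCompact U → IsClopen (f ⁻¹' U))
    (hg : ∀ U, IsOpen U → IsCompact U → IsClopen (g ⁻¹' U)) : IsClosed {y | g y ⤳ f y} := by
  -- Compact open sets form a basis, so they suffice to test specialisation; each one imposes a
  -- closed condition.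
  have : {y | g y ⤳ f y} =
      ⋂ U : {U : Set X // IsOpen U ∧ IsCompact U}, (f ⁻¹' U)ᶜ ∪ g ⁻¹' U := by
    ext y
    simp only [Set.mem_iInter, Set.mem_union, Set.mem_compl_iff, ← imp_iff_not_or]
    refine ⟨fun h U hU => h.mem_open U.2.1 hU, fun h => ?_⟩
    refine specializes_iff_forall_open.2 ?_
    intro V hV hfV
    obtain ⟨U, hU, hfU, hUV⟩ :=
      PrespectralSpace.isTopologicalBasis.exists_subset_of_mem_open hfV hV
    exact hUV (h ⟨U, hU⟩ hfU)
  rw [this]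
  exact isClosed_iInter fun U =>
    (hf U U.2.1 U.2.2).compl.isClosed.union (hg U U.2.1 U.2.2).isClosed

theorem isClopen_preimage_ofTopology {X : Type*} [TopologicalSpace X] {U : Set X}
    (hU : IsOpen U) (hUc : IsCompact U) :
    IsClopen ((WithTopology.ofTopology : WithConstructibleTopology X → X) ⁻¹' U) := by
  refine ⟨⟨?_⟩, WithConstructibleTopology.isOpen_iff.2
    (hUc.isOpen_constructibleTopology_of_isOpen hU)⟩
  exact WithConstructibleTopology.isOpen_iff.2 <|
    IsCompact.isOpen_constructibleTopology_of_isClosed (s := Uᶜ) (by rwa [compl_compl])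
      hU.isClosed_compl

/-! ### Weighted limits of domains and of spectral spaces -/

namespace TopT0

variable {D : Type u} [SmallCategory D] {W : D ⥤ PartOrd.{u}} {G : D ⥤ TopT0.{u}}

theorem WeightedCone.map_proj (c : WeightedCone W G) {d d' : D} (n : d ⟶ d') (x : W.obj d)
    (z : c.pt.pts) :
    toMap (G.map n) (toMap (c.proj d x) z) = toMap (c.proj d' (W.map n x)) z :=
  congrArg (fun f => toMap f z) (c.proj_map n x)

/-- The projections of a weighted limit of bounded complete algebraic domains, along maps preserving
directed suprema and non-empty infima. -/
theorem WeightedCone.IsLimit.isDomainSource {c : WeightedCone W G} (hc : c.IsLimit)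
    (hG : ∀ d, IsAlgebraicDomain (G.obj d).pts ∧ IsBoundedComplete (G.obj d).pts)
    (hG' : ∀ {d d' : D} (n : d ⟶ d'), ScottContinuous (toMap (G.map n)) ∧
      ∀ (S : Set (G.obj d).pts) (a : (G.obj d).pts), S.Nonempty → IsGLB S a →
        IsGLB (toMap (G.map n) '' S) (toMap (G.map n) a)) :
    IsDomainSource fun i : Σ d, W.obj d => (toMap (c.proj i.1 i.2) : c.pt.pts → (G.obj i.1).pts) where
  algebraic i := (hG i.1).1
  le_iff := WeightedCone.IsLimit.le_iff hc
  exists_sup S hS hd := by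
    have hdir (d : D) (x : W.obj d) : DirectedOn (· ≤ ·) (toMap (c.proj d x) '' S) :=
      hd.mono_comp fun _ _ h => Specializes.map h (toMap _).continuous
    choose p hp using fun (d : D) (x : W.obj d) =>
      (hG d).1.1 (toMap (c.proj d x) '' S) (hS.image _) (hdir d x)
    -- The componentwise suprema are natural because the diagram maps preserve directed suprema and
    -- suprema are unique.
    obtain ⟨a, ha⟩ := WeightedCone.IsLimit.exists_point hc (p := p)
      ⟨fun d x y hxy => (hp d x).2 <| by
          rintro _ ⟨s, hs, rfl⟩
          exact (c.proj_mono d x y hxy s).trans ((hp d y).1 ⟨s, hs, rfl⟩),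
        fun d d' n x => by
          have h := (hG' n).1 (hS.image _) (hdir d x) (hp d x)
          simp only [Set.image_image, WeightedCone.map_proj] at h
          exact h.unique (hp d' (W.map n x))⟩
    refine ⟨a, fun i => ?_⟩
    rw [ha]
    exact hp i.1 i.2
  exists_inf S hS := by
    choose p hp using fun (d : D) (x : W.obj d) =>
      (hG d).2.exists_isGLB (hS.image (toMap (c.proj d x)))
    obtain ⟨a, ha⟩ := WeightedCone.IsLimit.exists_point hc (p := p)
      ⟨fun d x y hxy => (hp d y).2 <| by
          rintro _ ⟨s, hs, rfl⟩
          exact ((hp d x).1 ⟨s, hs, rfl⟩).trans (c.proj_mono d x y hxy s),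
        fun d d' n x => by
          have h := (hG' n).2 _ _ (hS.image _) (hp d x)
          simp only [Set.image_image, WeightedCone.map_proj] at h
          exact h.unique (hp d' (W.map n x))⟩
    refine ⟨a, fun i => ?_⟩
    rw [ha]
    exact hp i.1 i.2

/-- A weighted limit of algebraic lattices has a greatest element, preserved by the projections. -/
theorem WeightedCone.IsLimit.exists_top {c : WeightedCone W G} (hc : c.IsLimit)
    (hG : ∀ d, ∃ a : (G.obj d).pts, IsGLB ∅ a)
    (hG' : ∀ {d d' : D} (n : d ⟶ d') (a : (G.obj d).pts), IsGLB ∅ a →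
      IsGLB ∅ (toMap (G.map n) a)) :
    ∃ a : c.pt.pts, ∀ d x, IsGLB ∅ (toMap (c.proj d x) a) := by
  choose p hp using hG
  obtain ⟨a, ha⟩ := WeightedCone.IsLimit.exists_point hc (p := fun d _ => p d)
    ⟨fun _ _ _ _ => le_rfl, fun d d' n _ => (hG' n _ (hp d)).unique (hp d')⟩
  refine ⟨a, fun d x => ?_⟩
  rw [ha]
  exact hp d

/-- Maps into a weighted limit which, composed with the projections, preserve an infimum preserve
it. -/
theorem WeightedCone.IsLimit.isGLB_image {c : WeightedCone W G} (hc : c.IsLimit) {A : TopT0.{u}}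
    (t : A ⟶ c.pt) {S : Set A.pts} {a : A.pts}
    (ha : ∀ d x, IsGLB (toMap (t ≫ c.proj d x) '' S) (toMap (t ≫ c.proj d x) a)) :
    IsGLB (toMap t '' S) (toMap t a) := by
  refine IsDomainSource.isGLB_of_forall (WeightedCone.IsLimit.le_iff hc) fun i => ?_
  rw [Set.image_image]
  exact ha i.1 i.2

theorem WeightedCone.IsLimit.scottContinuous {c : WeightedCone W G} (hc : c.IsLimit)
    {A : TopT0.{u}} (t : A ⟶ c.pt)
    (ht : ∀ d x, ScottContinuous (toMap (t ≫ c.proj d x))) : ScottContinuous (toMap t) := by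
  intro S hS hd a ha
  refine IsDomainSource.isLUB_of_forall (WeightedCone.IsLimit.le_iff hc) fun i => ?_
  rw [Set.image_image]
  exact ht i.1 i.2 hS hd ha

/-- A weighted limit of spectral spaces along spectral maps is spectral, with spectral
projections. -/
theorem WeightedCone.IsLimit.spectralSpace {c : WeightedCone W G} (hc : c.IsLimit)
    (hG : ∀ d, SpectralSpace (G.obj d).pts)
    (hG' : ∀ {d d' : D} (n : d ⟶ d'), IsSpectralMap (toMap (G.map n))) :
    SpectralSpace c.pt.pts ∧ ∀ d x, IsSpectralMap (toMap (c.proj d x)) := by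
  -- Compact by Tychonoff's theorem, as constructible topologies of spectral spaces are compact.
  let Y := ∀ d : D, W.obj d → WithConstructibleTopology (G.obj d).pts
  let ev (d : D) (x : W.obj d) (y : Y) : (G.obj d).pts := (y d x).ofTopology
  have hev (d : D) (x : W.obj d) (U : Set (G.obj d).pts) (hU : IsOpen U) (hUc : IsCompact U) :
      IsClopen (ev d x ⁻¹' U) :=
    (isClopen_preimage_ofTopology hU hUc).preimage
      ((continuous_apply x).comp (continuous_apply d))
  have hle {d : D} {f g : Y → (G.obj d).pts}
      (hf : ∀ U, IsOpen U → IsCompact U → IsClopen (f ⁻¹' U))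
      (hg : ∀ U, IsOpen U → IsCompact U → IsClopen (g ⁻¹' U)) : IsClosed {y | f y ≤ g y} :=
    isClosed_setOf_specializes_of_isClopen hf hg
  have hclosed : IsClosed {y : Y | IsCompatible W G fun d x => ev d x y} := by
    simp only [IsCompatible, Set.ofPred_and, Set.ofPred_forall]
    refine IsClosed.inter ?_ ?_
    · exact isClosed_iInter fun d => isClosed_iInter fun x => isClosed_iInter fun y =>
        isClosed_iInter fun _ => hle (hev d x) (hev d y)
    · refine isClosed_iInter fun d => isClosed_iInter fun d' => isClosed_iInter fun n =>
        isClosed_iInter fun x => ?_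
      -- Naturality becomes two inequalities, each closed because spectral maps pull compact open
      -- sets back to compact open sets.
      simp only [le_antisymm_iff, Set.ofPred_and]
      have hn (U : Set (G.obj d').pts) (hU : IsOpen U) (hUc : IsCompact U) :
          IsClopen ((fun y => toMap (G.map n) (ev d x y)) ⁻¹' U) :=
        hev d x _ (hU.preimage (toMap (G.map n)).continuous)
          ((hG' n).isCompact_preimage_of_isOpen hU hUc)
      exact (hle hn (hev d' _)).inter (hle (hev d' _) hn)
  have : CompactSpace {y : Y | IsCompatible W G fun d x => ev d x y} :=
    isCompact_iff_compactSpace.1 hclosed.isCompact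
  -- `q` sends a compatible family to the point of the limit that realises it.
  choose q hq using fun y : {y : Y | IsCompatible W G fun d x => ev d x y} =>
    WeightedCone.IsLimit.exists_point hc y.2
  have ht := WeightedCone.IsLimit.topology_eq hc
  have hclopen (i : Σ d, W.obj d) (U : Set (G.obj i.1).pts) (hU : IsOpen U) (hUc : IsCompact U) :
      IsClopen (q ⁻¹' (toMap (c.proj i.1 i.2) ⁻¹' U)) := by
    have : q ⁻¹' (toMap (c.proj i.1 i.2) ⁻¹' U) = Subtype.val ⁻¹' (ev i.1 i.2 ⁻¹' U) := by
      ext y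
      simp only [Set.mem_preimage, hq]
    rw [this]
    exact (hev i.1 i.2 U hU hUc).preimage continuous_subtype_val
  have hs : Function.Surjective q := fun z => by
    refine ⟨⟨fun d x => .toTopology _ (toMap (c.proj d x) z), WeightedCone.isCompatible c z⟩, ?_⟩
    refine le_antisymm ?_ ?_ <;>
    · refine (WeightedCone.IsLimit.le_iff hc _ _).2 fun i => ?_
      rw [hq]
  exact ⟨.of_isClopen_preimage ht hclopen hs,
    fun d x => IsSpectralMap.of_isClopen_preimage ht hclopen hs ⟨d, x⟩⟩

end TopT0

/-! ### Closure of the three subcategories -/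

theorem ADom_closedUnderWeightedLimits : ADom.{u}.ClosedUnderWeightedLimits := by
  refine ADom.closedUnderWeightedLimits_of_isLimit
    (fun D _ W G => ⟨_, compatibleCone_isLimit W G⟩) fun D _ W G c hc => ?_
  have h := WeightedCone.IsLimit.isDomainSource hc
    (fun d => ⟨(G.obj d).property.1, (G.obj d).property.2.1⟩) fun n => (G.map n).property
  have (i : Σ d, W.obj d) : Topology.IsScott ((G ⋙ ADom.incl).obj i.1).pts Set.univ :=
    (G.obj i.1).property.2.2
  refine ⟨⟨h.isAlgebraicDomain, h.isBoundedComplete,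
    h.isScott (WeightedCone.IsLimit.topology_eq hc)⟩,
    fun d x => ⟨h.scottContinuous ⟨d, x⟩, fun S a hS ha => h.map_isGLB ⟨d, x⟩ hS ha⟩,
    fun A t _ ht => ⟨WeightedCone.IsLimit.scottContinuous hc t fun d x => (ht d x).1,
      fun S a hS ha => WeightedCone.IsLimit.isGLB_image hc t fun d x => (ht d x).2 S a hS ha⟩⟩

theorem ALat_closedUnderWeightedLimits : ALat.{u}.ClosedUnderWeightedLimits := by
  refine ALat.closedUnderWeightedLimits_of_isLimit
    (fun D _ W G => ⟨_, compatibleCone_isLimit W G⟩) fun D _ W G c hc => ?_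
  have h := WeightedCone.IsLimit.isDomainSource hc
    (fun d => ⟨(G.obj d).property.1.1, fun S _ => (G.obj d).property.1.2 S⟩)
    fun n => ⟨(G.map n).property.1, fun S a _ => (G.map n).property.2 S a⟩
  have (i : Σ d, W.obj d) : Topology.IsScott ((G ⋙ ALat.incl).obj i.1).pts Set.univ :=
    (G.obj i.1).property.2
  obtain ⟨a, ha⟩ := WeightedCone.IsLimit.exists_top hc
    (fun d => by
      obtain ⟨a, ha⟩ := (G.obj d).property.1.2 Set.univ
      exact ⟨a, isGLB_empty_iff.2 fun x => ha.1 trivial⟩)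
    (fun n a ha => by
      have := (G.map n).property.2 ∅ a ha
      rwa [Set.image_empty] at this)
  have hatop (x : c.pt.pts) : x ≤ a := (h.le_iff _ _).2 fun i => isGLB_empty_iff.1 (ha i.1 i.2) _
  refine ⟨⟨⟨h.isAlgebraicDomain, fun S => h.isBoundedComplete S ⟨a, fun x _ => hatop x⟩⟩,
    h.isScott (WeightedCone.IsLimit.topology_eq hc)⟩,
    fun d x => ⟨h.scottContinuous ⟨d, x⟩, fun S b hb => ?_⟩,
    fun A t _ ht => ⟨WeightedCone.IsLimit.scottContinuous hc t fun d x => (ht d x).1,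
      fun S a ha => WeightedCone.IsLimit.isGLB_image hc t fun d x => (ht d x).2 S a ha⟩⟩
  -- An infimum of the empty set is the top element `a`, whose projections are top elements.
  obtain rfl | hS := S.eq_empty_or_nonempty
  · rw [Set.image_empty, le_antisymm (hatop b) (isGLB_empty_iff.1 hb a)]
    exact ha d x
  · exact h.map_isGLB ⟨d, x⟩ hS hb

theorem SpecSp_closedUnderWeightedLimits : SpecSp.{u}.ClosedUnderWeightedLimits := by
  refine SpecSp.closedUnderWeightedLimits_of_isLimit
    (fun D _ W G => ⟨_, compatibleCone_isLimit W G⟩) fun D _ W G c hc => ?_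
  have hG (d : D) : SpectralSpace ((G ⋙ SpecSp.incl).obj d).pts := (G.obj d).property
  obtain ⟨h, hproj⟩ := WeightedCone.IsLimit.spectralSpace hc hG fun n => (G.map n).property
  refine ⟨h, hproj, fun A t hA ht => ?_⟩
  have : SpectralSpace A.pts := hA
  exact IsSpectralMap.of_comp (WeightedCone.IsLimit.topology_eq hc) (toMap t).continuous
    fun i => ht i.1 i.2

theorem mainTheorem8 :
    ALat.{u}.ClosedUnderWeightedLimits ∧
      ADom.{u}.ClosedUnderWeightedLimits ∧
      SpecSp.{u}.ClosedUnderWeightedLimits :=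
  ⟨ALat_closedUnderWeightedLimits, ADom_closedUnderWeightedLimits,
    SpecSp_closedUnderWeightedLimits⟩
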